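/- Let $n,k\ge 0$ be integers and let $S_n$ be the set of permutations $\sigma=\sigma_1\cdots\sigma_n$ of $[n]=\{1,\dots,n\}$; write $$S(n,k)=\{\sigma\in S_n:\ \max_{1\le i\le n}(\sigma_i-i)\le k\}$$ (for $n=0$ the condition is vacuous). For $\sigma\in S_n$ let $\mathrm{inv}(\sigma)$ be the number of pairs $i<j$ with $\sigma_i>\sigma_j$; let $\mathrm{Rmil}(\sigma)=\{\sigma_i:\ \sigma_j>\sigma_i\text{ for all }j>i\}$ be the set of right-to-left minimum letters; and let $\mathrm{Cyc}(\sigma)$ be the set of the minimum elements of the cycles of $\sigma$ (fixed points included). Put $\mathrm{rmin}(\sigma)=|\mathrm{Rmil}(\sigma)|$ and $\mathrm{cyc}(\sigma)=|\mathrm{Cyc}(\sigma)|$. Every $\sigma\in S_n$ can be written in a unique way as a product of transpositions $\sigma=(i_1\,j_1)(i_2\,j_2)\cdots(i_r\,j_r)$, composed from right to left, with $j_1<\dots<j_r$ and $i_s<j_s$ for all $s$; the sorting index is $\mathrm{sor}(\sigma)=\sum_{s=1}^r(j_s-i_s)$. Let $\mathrm{SE}_n$ be the set of integer sequences $(a_1,\dots,a_n)$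 with $1\le a_i\le i$. The Lehmer code of $\sigma$ is $\mathrm{Leh}(\sigma)=(a_1,\dots,a_n)$ with $a_i=|\{j:\ 1\le j\le i,\ \sigma_j\le\sigma_i\}|$, and $\text{A-code}(\sigma)=\mathrm{Leh}(\sigma^{-1})$. Further, $\text{B-code}(\sigma)=(b_1,\dots,b_n)$ with $b_i=\sigma^{-k(i)}(i)$, where $k(i)$ is the smallest integer $m\ge1$ with $\sigma^{-m}(i)\le i$. **Theorem.** The maps $\text{A-code}$ and $\text{B-code}$ are bijections $S_n\to \mathrm{SE}_n$, so that $\gamma=(\text{B-code})^{-1}\circ\text{A-code}:S_n\to S_n$ is well defined. The map $\gamma$ restricts to a bijection of $S(n,k)$ onto itself, and for every $\sigma\in S(n,k)$ $$\mathrm{inv}(\sigma)=\mathrm{sor}(\gamma(\sigma)),\qquad \mathrm{Rmil}(\sigma)=\mathrm{Cyc}(\gamma(\sigma)).$$ Consequently $(\mathrm{inv},\mathrm{Rmil})$ and $(\mathrm{sor},\mathrm{Cyc})$ are equidistributed over $S(n,k)$, and so are $(\mathrm{inv},\mathrm{rmin})$ and $(\mathrm{sor},\mathrm{cyc})$: each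 value of the first pair is attained by as many elements of $S(n,k)$ as the same value of the second pair. -/

import Mathlib

/-! Permutations of `[n] = {1, …, n}` are elements of `Equiv.Perm (Fin n)`; the element `i : Fin n`
stands for the number `i + 1`, and `σ i` is the letter `σ_{i+1}` of the word of `σ`.
Code entries are genuine natural numbers, with `1 ≤ a_i ≤ i`. -/

namespace FoataHan

/-- The maximum of `σ_i - i` over all positions `i`; it is `⊥` only for the empty permutation. -/
def maxExc {n : ℕ} (σ : Equiv.Perm (Fin n)) : WithBot ℤ :=
  (Finset.univ.image fun i : Fin n => ((σ i : ℕ) : ℤ) - ((i : ℕ) : ℤ)).max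

/-- The set `S(n,k)` of permutations `σ` of `[n]` with `max_i (σ_i - i) ≤ k`. -/
def S (n k : ℕ) : Set (Equiv.Perm (Fin n)) :=
  {σ | maxExc σ ≤ ((k : ℤ) : WithBot ℤ)}

/-- The number of inversions. -/
def inv {n : ℕ} (σ : Equiv.Perm (Fin n)) : ℕ :=
  (Finset.univ.filter fun p : Fin n × Fin n => p.1 < p.2 ∧ σ p.2 < σ p.1).card

/-- The set of right-to-left minimum letters. -/
def Rmil {n : ℕ} (σ : Equiv.Perm (Fin n)) : Set (Fin n) :=
  {c | ∃ i, σ i = c ∧ ∀ j, i < j → σ i < σ j}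

/-- The number of right-to-left minimum letters. -/
noncomputable def rmin {n : ℕ} (σ : Equiv.Perm (Fin n)) : ℕ := (Rmil σ).ncard

/-- The set of minimum elements of the cycles, fixed points being cycles of length one. -/
def Cyc {n : ℕ} (σ : Equiv.Perm (Fin n)) : Set (Fin n) :=
  {c | ∀ j, σ.SameCycle c j → c ≤ j}

/-- The number of cycles. -/
noncomputable def cyc {n : ℕ} (σ : Equiv.Perm (Fin n)) : ℕ := (Cyc σ).ncard

/-- The list `(i₁,j₁), …, (i_r,j_r)` satisfies `j₁ < ⋯ < j_r`, `i_s < j_s` for all `s`, and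
`σ = (i₁ j₁) ⋯ (i_r j_r)`, where products of permutations are composed from right to left. -/
structure IsSortingDecomposition {n : ℕ} (σ : Equiv.Perm (Fin n)) (L : List (Fin n × Fin n)) :
    Prop where
  increasing : L.Pairwise fun p q => p.2 < q.2
  lt : ∀ p ∈ L, p.1 < p.2
  prod_eq : (L.map fun p => Equiv.swap p.1 p.2).prod = σ

theorem prod_swap_fix {n : ℕ} (m : Fin n) (L : List (Fin n × Fin n))
    (h1 : ∀ p ∈ L, p.1 < p.2) (h2 : ∀ p ∈ L, p.2 < m) :
    (L.map fun p => Equiv.swap p.1 p.2).prod m = m := by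
  induction L with
  | nil => simp
  | cons p L ih =>
    have hp1 := h1 p (by simp)
    have hp2 := h2 p (by simp)
    rw [List.map_cons, List.prod_cons, Equiv.Perm.mul_apply,
      ih (fun q hq => h1 q (by simp [hq])) (fun q hq => h2 q (by simp [hq]))]
    exact Equiv.swap_apply_of_ne_of_ne (hp1.trans hp2).ne' hp2.ne'

theorem existsUnique_aux {n : ℕ} (m : ℕ) : ∀ σ : Equiv.Perm (Fin n),
    (∀ i : Fin n, m ≤ i → σ i = i) →
    ∃! L : List (Fin n × Fin n), IsSortingDecomposition σ L ∧ ∀ p ∈ L, (p.2 : ℕ) < m := by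
  induction m with
  | zero =>
    intro σ hσ
    refine ⟨[], ⟨⟨by simp, by simp, ?_⟩, by simp⟩, ?_⟩
    · ext i; simp [hσ i]
    · rintro L ⟨-, hL⟩
      exact List.eq_nil_iff_forall_not_mem.2 fun p hp => absurd (hL p hp) (by omega)
  | succ m ih =>
    intro σ hσ
    -- the last entry of an admissible list moves `m`, if `m` is the second entry of a pair
    have key : ∀ (L : List (Fin n × Fin n)), IsSortingDecomposition σ L →
        (∀ p ∈ L, (p.2 : ℕ) < m + 1) →
        (∀ p ∈ L, (p.2 : ℕ) < m) ∨
        ∃ L' q, L = L' ++ [q] ∧ (q.2 : ℕ) = m ∧ σ q.1 = q.2 ∧ q.1 < q.2 ∧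
          IsSortingDecomposition (σ * Equiv.swap q.1 q.2) L' ∧ ∀ p ∈ L', (p.2 : ℕ) < m := by
      intro L hL hb
      rcases List.eq_nil_or_concat L with rfl | ⟨L', q, rfl⟩
      · left; simp
      simp only [List.concat_eq_append] at hL hb ⊢
      have hinc := hL.increasing
      rw [List.pairwise_append] at hinc
      have hlt : ∀ p ∈ L', p.2 < q.2 := fun p hp => hinc.2.2 p hp q (by simp)
      have hqb := hb q (by simp)
      by_cases hq : (q.2 : ℕ) = m
      · right
        have hprod := hL.prod_eq
        rw [List.map_append, List.prod_append] at hprod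
        simp only [List.map_cons, List.map_nil, List.prod_cons, List.prod_nil, mul_one] at hprod
        have hL'lt : ∀ p ∈ L', p.1 < p.2 := fun p hp => hL.lt p (by simp [hp])
        refine ⟨L', q, rfl, hq, ?_, hL.lt q (by simp), ⟨hinc.1, hL'lt, ?_⟩, ?_⟩
        · rw [← hprod, Equiv.Perm.mul_apply, Equiv.swap_apply_left]
          exact prod_swap_fix q.2 L' hL'lt hlt
        · rw [← hprod, mul_assoc, Equiv.swap_mul_self, mul_one]
        · intro p hp
          have := hlt p hp
          rw [Fin.lt_def] at this
          omega
      · left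
        intro p hp
        rcases List.mem_append.1 hp with hp | hp
        · have := hlt p hp
          rw [Fin.lt_def] at this
          omega
        · rw [List.mem_singleton.1 hp]; omega
    by_cases hm : ∃ j : Fin n, (j : ℕ) = m ∧ σ j ≠ j
    · obtain ⟨j, hj, hσj⟩ := hm
      obtain ⟨i, hi⟩ := σ.surjective j
      have hij : i < j := by
        by_contra hcon
        rcases (not_lt.1 hcon).eq_or_lt with h | h
        · subst h; exact hσj hi
        · have h3 := hσ i (by rw [Fin.lt_def] at h; omega)
          rw [h3] at hi
          exact h.ne' hi
      have hfix : ∀ x : Fin n, m ≤ x → (σ * Equiv.swap i j) x = x := by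
        intro x hx
        rw [Equiv.Perm.mul_apply]
        by_cases hxj : x = j
        · subst hxj; rw [Equiv.swap_apply_right, hi]
        · have hxi : x ≠ i := by
            rintro rfl; rw [Fin.lt_def] at hij; omega
          rw [Equiv.swap_apply_of_ne_of_ne hxi hxj]
          refine hσ x ?_
          have : (x : ℕ) ≠ j := fun h => hxj (Fin.ext h)
          omega
      obtain ⟨L₀, ⟨hL₀, hb₀⟩, huniq⟩ := ih _ hfix
      refine ⟨L₀ ++ [(i, j)], ⟨⟨?_, ?_, ?_⟩, ?_⟩, ?_⟩
      · rw [List.pairwise_append]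
        refine ⟨hL₀.increasing, by simp, ?_⟩
        intro p hp q hq
        rw [List.mem_singleton.1 hq, Fin.lt_def]
        have := hb₀ p hp
        simp only
        omega
      · intro p hp
        rcases List.mem_append.1 hp with hp | hp
        · exact hL₀.lt p hp
        · rw [List.mem_singleton.1 hp]; exact hij
      · rw [List.map_append, List.prod_append, hL₀.prod_eq]
        simp [mul_assoc]
      · intro p hp
        rcases List.mem_append.1 hp with hp | hp
        · exact (hb₀ p hp).trans (Nat.lt_succ_self m)
        · rw [List.mem_singleton.1 hp]; simp only; omega
      · rintro L ⟨hL, hb⟩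
        rcases key L hL hb with h | ⟨L', q, rfl, hq, hσq, -, hL', hb'⟩
        · exfalso
          apply hσj
          rw [← hL.prod_eq]
          exact prod_swap_fix j L hL.lt fun p hp => by
            rw [Fin.lt_def, hj]; exact h p hp
        · have hq2 : q.2 = j := Fin.ext (by omega)
          have hq1 : q.1 = i := σ.injective (by rw [hσq, hq2, hi])
          rw [hq1, hq2] at hL'
          rw [huniq L' ⟨hL', hb'⟩, ← hq1, ← hq2]
    · push Not at hm
      obtain ⟨L₀, ⟨hL₀, hb₀⟩, huniq⟩ := ih σ fun i hi => by
        rcases hi.eq_or_lt with h | h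
        · exact hm i h.symm
        · exact hσ i h
      refine ⟨L₀, ⟨hL₀, fun p hp => (hb₀ p hp).trans (Nat.lt_succ_self m)⟩, ?_⟩
      rintro L ⟨hL, hb⟩
      rcases key L hL hb with h | ⟨L', q, rfl, hq, hσq, hlt, -, -⟩
      · exact huniq L ⟨hL, h⟩
      · exact absurd (σ.injective (hσq.trans (hm q.2 hq).symm)) hlt.ne

/-- Every permutation has exactly one such decomposition. -/
theorem existsUnique_sortingDecomposition {n : ℕ} (σ : Equiv.Perm (Fin n)) :
    ∃! L : List (Fin n × Fin n), IsSortingDecomposition σ L := by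
  obtain ⟨L, ⟨hL, -⟩, hu⟩ := existsUnique_aux n σ fun i hi => absurd i.isLt (by omega)
  exact ⟨L, hL, fun L' hL' => hu L' ⟨hL', fun p _ => p.2.isLt⟩⟩

/-- The sorting index: the sum of `j_s - i_s` over the unique decomposition
`σ = (i₁ j₁) ⋯ (i_r j_r)` with `j₁ < ⋯ < j_r` and `i_s < j_s`. -/
noncomputable def sor {n : ℕ} (σ : Equiv.Perm (Fin n)) : ℕ :=
  ((existsUnique_sortingDecomposition σ).choose.map fun p => (p.2 : ℕ) - (p.1 : ℕ)).sum

/-- The set `SE_n` of sequences `(a_1, …, a_n)` with `1 ≤ a_i ≤ i`. -/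
def SE (n : ℕ) : Type := {a : Fin n → ℕ // ∀ i : Fin n, 1 ≤ a i ∧ a i ≤ (i : ℕ) + 1}

/-- The Lehmer code `a_i = |{j : 1 ≤ j ≤ i, σ_j ≤ σ_i}|`. -/
def leh {n : ℕ} (σ : Equiv.Perm (Fin n)) : SE n :=
  ⟨fun i => (Finset.univ.filter fun j : Fin n => j ≤ i ∧ σ j ≤ σ i).card, fun i => by
    constructor
    · exact Finset.card_pos.2 ⟨i, by simp⟩
    · calc _ ≤ (Finset.Iic i).card := Finset.card_le_card fun j hj => by
            simp only [Finset.mem_filter, Finset.mem_univ, true_and] at hj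
            simpa using hj.1
        _ = (i : ℕ) + 1 := Fin.card_Iic i⟩

/-- The A-code: the Lehmer code of the inverse permutation. -/
def aCode {n : ℕ} (σ : Equiv.Perm (Fin n)) : SE n := leh σ⁻¹

theorem exists_inv_pow_le {n : ℕ} (σ : Equiv.Perm (Fin n)) (i : Fin n) :
    ∃ k : ℕ, 1 ≤ k ∧ (σ⁻¹ ^ k) i ≤ i :=
  ⟨orderOf σ⁻¹, orderOf_pos _, by rw [pow_orderOf_eq_one]; simp⟩

/-- The smallest integer `k ≥ 1` with `σ^{-k}(i) ≤ i`. -/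
def returnTime {n : ℕ} (σ : Equiv.Perm (Fin n)) (i : Fin n) : ℕ :=
  Nat.find (exists_inv_pow_le σ i)

/-- The B-code: `b_i = σ^{-k(i)}(i)`, where `k(i)` is the smallest `k ≥ 1` with
`σ^{-k}(i) ≤ i`. -/
def bCode {n : ℕ} (σ : Equiv.Perm (Fin n)) : SE n :=
  ⟨fun i => ((σ⁻¹ ^ returnTime σ i) i : ℕ) + 1, fun i =>
    ⟨Nat.le_add_left 1 _, Nat.succ_le_succ (Nat.find_spec (exists_inv_pow_le σ i)).2⟩⟩

/-- The Foata–Han map `γ = (B-code)⁻¹ ∘ A-code`. Here `Function.invFun` is the two-sided inverse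
of the B-code as soon as the B-code is a bijection. -/
noncomputable def gamma {n : ℕ} (σ : Equiv.Perm (Fin n)) : Equiv.Perm (Fin n) :=
  Function.invFun bCode (aCode σ)

end FoataHan

namespace FoataHan

open Equiv

variable {n : ℕ}

/-! Everything is read off the code, by the same rule for both codes. With zero-based `c`, let the
deficit of a code `a` at `c` be `c + 1 - a c`. For the A-code the deficits sum to `inv`
(`inv_eq_sum`), vanish exactly on `Rmil` (`Rmil_eq`), and are all at most `k` exactly on `S n k`
(`mem_S_iff_aCode`). For the B-code the same holds with `sor` and `Cyc` (`sor_eq_sum`, `Cyc_eq`,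
`mem_S_iff_bCode`). Since the B-code of `gamma σ` is the A-code of `σ`, all claims about `gamma`
follow.

Both codes map into a set of `n!` elements, so injectivity suffices for bijectivity. -/

theorem perm_inv_apply (σ : Perm (Fin n)) (x : Fin n) : σ⁻¹ (σ x) = x :=
  σ.symm_apply_apply x

theorem perm_apply_inv (σ : Perm (Fin n)) (x : Fin n) : σ (σ⁻¹ x) = x :=
  σ.apply_symm_apply x

theorem mem_S_iff {k : ℕ} {σ : Perm (Fin n)} :
    σ ∈ S n k ↔ ∀ i, (σ i : ℕ) ≤ i + k := by
  simp only [S, maxExc, Set.mem_ofPred_eq, Finset.max_le_iff, Finset.mem_image, Finset.mem_univ,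
    true_and, forall_exists_index, forall_apply_eq_imp_iff, WithBot.coe_le_coe]
  exact forall_congr' fun i => by omega

theorem SE_ext {a b : SE n} (h : ∀ i, a.1 i = b.1 i) : a = b :=
  Subtype.ext (funext h)

/-- Sequences in `SE n` are the elements of a product of finite intervals. -/
def SEEquivPi (n : ℕ) : SE n ≃ ((i : Fin n) → Fin ((i : ℕ) + 1)) where
  toFun a i := ⟨a.1 i - 1, by have := a.2 i; omega⟩
  invFun f := ⟨fun i => f i + 1, fun i => by have := (f i).isLt; simp only; omega⟩
  left_inv a := SE_ext fun i => by have := a.2 i; simp only; omega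
  right_inv f := by ext i; simp

instance : Fintype (SE n) := Fintype.ofEquiv _ (SEEquivPi n).symm

theorem card_SE : Fintype.card (SE n) = n.factorial := by
  rw [Fintype.card_congr (SEEquivPi n), Fintype.card_pi]
  simp only [Fintype.card_fin]
  rw [Fin.prod_univ_eq_prod_range (fun i => i + 1) n, Finset.prod_range_add_one_eq_factorial]

theorem bijective_of_injective_SE {f : Perm (Fin n) → SE n} (hf : Function.Injective f) :
    Function.Bijective f :=
  (Fintype.bijective_iff_injective_and_card f).2
    ⟨hf, by rw [card_SE, Fintype.card_perm, Fintype.card_fin]⟩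

/-! ### The Lehmer code -/

theorem leh_apply (τ : Perm (Fin n)) (c : Fin n) :
    (leh τ).1 c = (Finset.univ.filter fun j : Fin n => j ≤ c ∧ τ j ≤ τ c).card :=
  rfl

theorem leh_add_card (τ : Perm (Fin n)) (c : Fin n) :
    (leh τ).1 c + (Finset.univ.filter fun d => d < c ∧ τ c < τ d).card = c + 1 := by
  rw [← Fin.card_Iic c, leh_apply, ← Finset.card_union_of_disjoint]
  · congr 1
    ext d
    simp only [Finset.mem_union, Finset.mem_filter, Finset.mem_univ, true_and, Finset.mem_Iic]
    constructor
    · rintro (h | h)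
      exacts [h.1, h.1.le]
    · intro h
      rcases le_or_gt (τ d) (τ c) with h' | h'
      · exact Or.inl ⟨h, h'⟩
      · exact Or.inr ⟨lt_of_le_of_ne h (by rintro rfl; exact h'.false), h'⟩
  · rw [Finset.disjoint_filter]
    exact fun d _ h h' => h'.2.not_ge h.2

theorem leh_eq_iff (τ : Perm (Fin n)) (c : Fin n) :
    (leh τ).1 c = c + 1 ↔ ∀ d, d < c → τ d < τ c := by
  have h := leh_add_card τ c
  have h0 : (leh τ).1 c = c + 1 ↔ (Finset.univ.filter fun d => d < c ∧ τ c < τ d).card = 0 := by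
    omega
  rw [h0, Finset.card_eq_zero, Finset.filter_eq_empty_iff]
  refine forall_congr' fun d => ?_
  simp only [Finset.mem_univ, true_implies, not_and, not_lt]
  exact forall_congr' fun hd =>
    ⟨fun h => lt_of_le_of_ne h (τ.injective.ne hd.ne), le_of_lt⟩

/-- Inversions are grouped by their larger letter `c`: the deficit at `c` counts the smaller letters
standing to its right. -/
theorem inv_eq_sum (σ : Perm (Fin n)) : inv σ = ∑ c : Fin n, ((c : ℕ) + 1 - (aCode σ).1 c) := by
  have h1 : ∀ c : Fin n, (c : ℕ) + 1 - (aCode σ).1 c =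
      (Finset.univ.filter fun d => d < c ∧ σ⁻¹ c < σ⁻¹ d).card := fun c => by
    have := leh_add_card σ⁻¹ c
    rw [aCode]
    omega
  simp only [h1]
  rw [← Finset.card_sigma, inv]
  refine Finset.card_nbij' (fun p => ⟨σ p.1, σ p.2⟩) (fun q => (σ⁻¹ q.1, σ⁻¹ q.2)) ?_ ?_ ?_ ?_
  · intro p hp
    simpa [and_comm] using hp
  · intro q hq
    simpa [and_comm] using hq
  · intro p _
    simp
  · intro q _
    simp

/-- A letter is a right-to-left minimum iff all smaller letters stand to its left, that is, iff it
has deficit zero. -/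
theorem Rmil_eq (σ : Perm (Fin n)) : Rmil σ = {c | (aCode σ).1 c = c + 1} := by
  ext c
  simp only [Rmil, Set.mem_ofPred_eq, aCode, leh_eq_iff]
  constructor
  · rintro ⟨i, rfl, h⟩ d hd
    by_contra hcon
    rw [not_lt, perm_inv_apply] at hcon
    rcases hcon.eq_or_lt with h' | h'
    · rw [h', perm_apply_inv] at hd
      exact hd.false
    · have := h _ h'
      rw [perm_apply_inv] at this
      exact this.not_gt hd
  · intro h
    refine ⟨σ⁻¹ c, by simp, fun j hj => ?_⟩
    rw [perm_apply_inv]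
    by_contra hcon
    rcases (not_lt.1 hcon).eq_or_lt with h' | h'
    · rw [← h', perm_inv_apply] at hj
      exact hj.false
    · have := h _ h'
      rw [perm_inv_apply] at this
      exact this.not_gt hj

theorem leh_le (τ : Perm (Fin n)) (c : Fin n) : (leh τ).1 c ≤ τ c + 1 := by
  rw [leh_apply, ← Fin.card_Iic (τ c)]
  refine Finset.card_le_card_of_injOn τ (fun d hd => ?_) τ.injective.injOn
  simp only [Finset.coe_filter, Set.mem_ofPred_eq, Finset.mem_univ, true_and] at hd
  simpa using hd.2

/-- Every value `x ≤ c - k` sits at a position at most `x + k ≤ c`, and `c - k ≤ τ c`; so all these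
values are counted by the code at `c`. -/
theorem le_leh_of_forall {k : ℕ} {τ : Perm (Fin n)} (h : ∀ c : Fin n, (c : ℕ) ≤ τ c + k) (c : Fin n) :
    (c : ℕ) + 1 ≤ (leh τ).1 c + k := by
  rcases lt_or_ge (c : ℕ) k with hk | hk
  · have := (leh τ).2 c
    omega
  let v : Fin n := ⟨c - k, by omega⟩
  have h1 : (Finset.Iic v).card ≤ (leh τ).1 c := by
    rw [leh_apply]
    refine Finset.card_le_card_of_injOn (τ⁻¹ : Perm (Fin n)) (fun x hx => ?_)
      (τ⁻¹ : Perm (Fin n)).injective.injOn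
    simp only [Finset.coe_Iic, Set.mem_Iic, Fin.le_def, v] at hx
    simp only [Finset.coe_filter, Finset.mem_univ, true_and, Set.mem_ofPred_eq,
      perm_apply_inv, Fin.le_def]
    have h2 := h (τ⁻¹ x)
    have h3 := h c
    rw [perm_apply_inv] at h2
    omega
  rw [Fin.card_Iic] at h1
  simp only [v] at h1
  omega

theorem mem_S_iff_aCode {k : ℕ} {σ : Perm (Fin n)} :
    σ ∈ S n k ↔ ∀ c : Fin n, (c : ℕ) + 1 ≤ (aCode σ).1 c + k := by
  rw [mem_S_iff]
  constructor
  · intro h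
    exact le_leh_of_forall fun c => by simpa using h (σ⁻¹ c)
  · intro h i
    have h1 := h (σ i)
    have h2 := leh_le σ⁻¹ (σ i)
    rw [perm_inv_apply] at h2
    rw [aCode] at h1
    omega

/-- Two permutations with the same Lehmer code order every initial segment of positions in the
same way. -/
theorem lt_iff_lt_of_leh_eq {τ ρ : Perm (Fin n)} (h : leh τ = leh ρ) (m : ℕ) :
    ∀ i j : Fin n, (i : ℕ) < m → (j : ℕ) < m → (τ i < τ j ↔ ρ i < ρ j) := by
  induction m with
  | zero => intro i j hi; omega
  | succ m ih =>
    have key : ∀ c : Fin n, (c : ℕ) = m → ∀ d, d < c → (τ c < τ d ↔ ρ c < ρ d) := by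
      intro c hc
      have hcard : (Finset.univ.filter fun d => d < c ∧ τ c < τ d).card =
          (Finset.univ.filter fun d => d < c ∧ ρ c < ρ d).card := by
        have h1 := leh_add_card τ c
        have h2 := leh_add_card ρ c
        rw [h] at h1
        omega
      have hset : (Finset.univ.filter fun d => d < c ∧ τ c < τ d) =
          (Finset.univ.filter fun d => d < c ∧ ρ c < ρ d) := by
        -- Both sets are upper sets for the common order that `τ` and `ρ` induce on the positions
        -- before `c`. Hence one contains the other, and equal cardinality forces equality.
        by_cases hsub : (Finset.univ.filter fun d => d < c ∧ τ c < τ d) ⊆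
            (Finset.univ.filter fun d => d < c ∧ ρ c < ρ d)
        · exact Finset.eq_of_subset_of_card_le hsub hcard.ge
        · obtain ⟨x, hx, hx'⟩ := Finset.not_subset.1 hsub
          simp only [Finset.mem_filter, Finset.mem_univ, true_and, not_and, not_lt] at hx hx'
          refine (Finset.eq_of_subset_of_card_le (fun y hy => ?_) hcard.le).symm
          simp only [Finset.mem_filter, Finset.mem_univ, true_and] at hy ⊢
          have hxy : ρ x < ρ y := (hx' hx.1).trans_lt hy.2
          refine ⟨hy.1, hx.2.trans ((ih x y ?_ ?_).2 hxy)⟩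
          · have := hx.1; rw [Fin.lt_def] at this; omega
          · have := hy.1; rw [Fin.lt_def] at this; omega
      intro d hd
      have := Finset.ext_iff.1 hset d
      simpa [hd] using this
    intro i j hi hj
    rcases (Nat.lt_succ_iff.1 hi).eq_or_lt with hi' | hi' <;>
      rcases (Nat.lt_succ_iff.1 hj).eq_or_lt with hj' | hj'
    · have : i = j := Fin.ext (by omega)
      subst this
      simp
    · exact key i hi' j (by rw [Fin.lt_def]; omega)
    · have hij : i < j := by rw [Fin.lt_def]; omega
      have := key j hj' i hij
      rw [← not_le, ← not_le, (τ.injective.ne hij.ne').le_iff_lt,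
        (ρ.injective.ne hij.ne').le_iff_lt, this]
    · exact ih i j hi' hj'

theorem leh_injective : Function.Injective (leh : Perm (Fin n) → SE n) := by
  intro τ ρ h
  have hmono : StrictMono (ρ * τ⁻¹ : Perm (Fin n)) := fun x y hxy => by
    have := lt_iff_lt_of_leh_eq h n (τ⁻¹ x) (τ⁻¹ y) (Fin.is_lt _) (Fin.is_lt _)
    rw [perm_apply_inv, perm_apply_inv] at this
    exact this.1 hxy
  have hid : ∀ x, (ρ * τ⁻¹ : Perm (Fin n)) x = x := fun x =>
    DFunLike.congr_fun (Subsingleton.elim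
      (hmono.orderIsoOfSurjective _ (ρ * τ⁻¹ : Perm (Fin n)).surjective) (OrderIso.refl _)) x
  ext i
  have := hid (τ i)
  rw [Perm.mul_apply, perm_inv_apply] at this
  rw [this]

theorem aCode_bijective : Function.Bijective (aCode : Perm (Fin n) → SE n) :=
  bijective_of_injective_SE (leh_injective.comp inv_injective)

/-! ### The B-code -/

/-- `BackReach σ c y` says that `y` is reached from `c` by at least one application of `σ⁻¹`, all
intermediate values being larger than `c`. -/
inductive BackReach (σ : Perm (Fin n)) (c : Fin n) : Fin n → Prop
  | base : BackReach σ c (σ⁻¹ c)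
  | step {y : Fin n} : BackReach σ c y → c < y → BackReach σ c (σ⁻¹ y)

theorem lt_of_lt_returnTime {σ : Perm (Fin n)} {c : Fin n} {l : ℕ} (h1 : 1 ≤ l)
    (h : l < returnTime σ c) : c < (σ⁻¹ ^ l) c := by
  have := Nat.find_min (exists_inv_pow_le σ c) h
  exact not_le.1 fun h' => this ⟨h1, h'⟩

theorem backReach_pow (σ : Perm (Fin n)) (c : Fin n) (l : ℕ) (h : l + 1 ≤ returnTime σ c) :
    BackReach σ c ((σ⁻¹ ^ (l + 1)) c) := by
  induction l with
  | zero => simpa using BackReach.base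
  | succ l ih =>
    rw [pow_succ', Perm.mul_apply]
    exact (ih (by omega)).step (lt_of_lt_returnTime (by omega) (by omega))

theorem BackReach.exists_pow {σ : Perm (Fin n)} {c y : Fin n} (h : BackReach σ c y) :
    ∃ l, 1 ≤ l ∧ l ≤ returnTime σ c ∧ y = (σ⁻¹ ^ l) c := by
  have hpos := (Nat.find_spec (exists_inv_pow_le σ c)).1
  induction h with
  | base => exact ⟨1, le_rfl, hpos, by simp⟩
  | step h hlt ih =>
    obtain ⟨l, h1, h2, rfl⟩ := ih
    refine ⟨l + 1, by omega, lt_of_le_of_ne h2 ?_, by rw [pow_succ', Perm.mul_apply]⟩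
    rintro rfl
    exact (Nat.find_spec (exists_inv_pow_le σ c)).2.not_gt hlt

/-- A backward path stops as soon as it meets a value at most `c`, so the first return is the only
such value it reaches. This replaces return times by inductions on `BackReach`. -/
theorem bCode_eq_iff {σ : Perm (Fin n)} {c y : Fin n} :
    (bCode σ).1 c = y + 1 ↔ BackReach σ c y ∧ y ≤ c := by
  have hspec := Nat.find_spec (exists_inv_pow_le σ c)
  have hb : (bCode σ).1 c = y + 1 ↔ (σ⁻¹ ^ returnTime σ c) c = y := by
    rw [bCode, Fin.ext_iff]
    exact Nat.add_right_cancel_iff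
  rw [hb]
  constructor
  · rintro rfl
    refine ⟨?_, hspec.2⟩
    obtain ⟨l, hl⟩ := Nat.exists_eq_add_of_le' hspec.1
    have h := backReach_pow σ c l hl.ge
    rwa [← hl] at h
  · rintro ⟨h, hy⟩
    obtain ⟨l, h1, h2, rfl⟩ := h.exists_pow
    rcases h2.eq_or_lt with rfl | h3
    · rfl
    · exact absurd hy (lt_of_lt_returnTime h1 h3).not_ge

theorem exists_bCode_eq (σ : Perm (Fin n)) (c : Fin n) :
    ∃ y : Fin n, (bCode σ).1 c = y + 1 :=
  ⟨_, rfl⟩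

theorem bCode_of_inv_le {σ : Perm (Fin n)} {c : Fin n} (h : σ⁻¹ c ≤ c) :
    (bCode σ).1 c = (σ⁻¹ c : Fin n) + 1 :=
  bCode_eq_iff.2 ⟨.base, h⟩

theorem BackReach.le_apply {σ : Perm (Fin n)} {c y : Fin n} (h : BackReach σ c y) :
    c ≤ σ y := by
  cases h with
  | base => simp
  | step _ h => simpa using h.le

/-- If `y` is the first return from `c`, its predecessor `σ y` on the path is at least `c`, so the
deficit is at most `σ y - y`. Conversely, when `i ≤ σ i`, the path from `σ i` returns to `i` in one
step and the deficit equals `σ i - i`. -/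
theorem mem_S_iff_bCode {k : ℕ} {σ : Perm (Fin n)} :
    σ ∈ S n k ↔ ∀ c : Fin n, (c : ℕ) + 1 ≤ (bCode σ).1 c + k := by
  rw [mem_S_iff]
  constructor
  · intro h c
    obtain ⟨y, hy⟩ := exists_bCode_eq σ c
    have h1 := (bCode_eq_iff.1 hy).1.le_apply
    have h2 := h y
    rw [Fin.le_def] at h1
    omega
  · intro h i
    rcases le_total i (σ i) with hi | hi
    · have h1 := h (σ i)
      rw [bCode_of_inv_le (by simpa using hi), perm_inv_apply] at h1
      omega
    · rw [Fin.le_def] at hi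
      omega

theorem BackReach.sameCycle {σ : Perm (Fin n)} {c y : Fin n} (h : BackReach σ c y) :
    σ.SameCycle c y := by
  obtain ⟨l, -, -, rfl⟩ := h.exists_pow
  rw [← Perm.sameCycle_inv]
  exact ⟨l, by simp⟩

theorem Cyc_eq (σ : Perm (Fin n)) : Cyc σ = {c | (bCode σ).1 c = c + 1} := by
  ext c
  simp only [Cyc, Set.mem_ofPred_eq]
  constructor
  · intro h
    obtain ⟨y, hy⟩ := exists_bCode_eq σ c
    have h1 := bCode_eq_iff.1 hy
    rw [hy, le_antisymm h1.2 (h y h1.1.sameCycle)]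
  · intro h
    have hret := (bCode_eq_iff.1 h).1
    -- If the first return is `c` itself, the path has run through the whole cycle without going
    -- below `c`.
    have hclosed : ∀ l : ℕ, BackReach σ c ((σ⁻¹ ^ l) c) ∧ c ≤ (σ⁻¹ ^ l) c := by
      intro l
      induction l with
      | zero => exact ⟨by simpa using hret, by simp⟩
      | succ l ih =>
        have hr : BackReach σ c ((σ⁻¹ ^ (l + 1)) c) := by
          rw [pow_succ', Perm.mul_apply]
          rcases ih.2.eq_or_lt with h' | h'
          · rw [← h']
            exact .base
          · exact ih.1.step h'
        refine ⟨hr, not_lt.1 fun hlt => ?_⟩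
        have h2 := bCode_eq_iff.2 ⟨hr, hlt.le⟩
        rw [h] at h2
        rw [Fin.lt_def] at hlt
        omega
    intro j hj
    obtain ⟨l, -, -, rfl⟩ := (Perm.sameCycle_inv.2 hj).exists_pow_eq
    exact (hclosed l).2

/-- Removing a letter `j` larger than `c` from its cycle does not change what `c` reaches. -/
theorem BackReach.of_mul_swap {σ : Perm (Fin n)} {i j c y : Fin n} (hij : σ i = j) (hc : c < j)
    (h : BackReach (σ * swap i j) c y) : BackReach σ c y := by
  have hi : σ⁻¹ j = i := by rw [← hij, perm_inv_apply]
  have key : ∀ x, x ≠ j → BackReach σ c (σ⁻¹ x) → BackReach σ c ((σ * swap i j)⁻¹ x) := by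
    intro x hx hr
    rw [mul_inv_rev, swap_inv, Perm.mul_apply]
    -- One step that skips `j` is two steps for `σ`, allowed because `c < j`.
    by_cases hxj : σ⁻¹ x = j
    · rw [hxj, swap_apply_right, ← hi]
      exact (hxj ▸ hr).step hc
    · rwa [swap_apply_of_ne_of_ne (fun h' => hx ?_) hxj]
      rw [← hij, ← h', perm_apply_inv]
  induction h with
  | base => exact key c hc.ne .base
  | @step y _ hlt ih =>
    -- The modified permutation fixes `j`, so this step does not move.
    by_cases hy : y = j
    · rw [hy, mul_inv_rev, swap_inv, Perm.mul_apply, hi, swap_apply_left, ← hy]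
      exact ih
    · exact key y hy (ih.step hlt)

theorem bCode_mul_swap_of_lt {σ : Perm (Fin n)} {i j c : Fin n} (hij : σ i = j) (hc : c < j) :
    (bCode (σ * swap i j)).1 c = (bCode σ).1 c := by
  obtain ⟨y, hy⟩ := exists_bCode_eq (σ * swap i j) c
  have h := bCode_eq_iff.1 hy
  rw [hy, bCode_eq_iff.2 ⟨h.1.of_mul_swap hij hc, h.2⟩]

theorem bCode_of_fixed {σ : Perm (Fin n)} {c : Fin n} (h : σ c = c) :
    (bCode σ).1 c = c + 1 := by
  have h' : σ⁻¹ c = c := by rw [Perm.inv_eq_iff_eq, h]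
  rw [bCode_of_inv_le h'.le, h']

theorem bCode_mul_swap_of_ne {σ : Perm (Fin n)} {i j c : Fin n} (hij : σ i = j) (hle : i ≤ j)
    (hfix : ∀ x, j < x → σ x = x) (hc : c ≠ j) :
    (bCode (σ * swap i j)).1 c = (bCode σ).1 c := by
  rcases lt_or_gt_of_ne hc with h | h
  · exact bCode_mul_swap_of_lt hij h
  · rw [bCode_of_fixed (hfix c h), bCode_of_fixed]
    rw [Perm.mul_apply, swap_apply_of_ne_of_ne (hle.trans_lt h).ne' hc, hfix c h]

/-- Let `j` have index `m`. All larger letters are fixed, so `σ⁻¹ j ≤ j` and the entry at `j`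
reveals `σ⁻¹ j`. Multiplying by `swap (σ⁻¹ j) j` fixes `j` and keeps the other entries, so induction
applies. -/
theorem eq_of_bCode_eq (m : ℕ) : ∀ σ ρ : Perm (Fin n), (∀ x : Fin n, m ≤ x → σ x = x) →
    (∀ x : Fin n, m ≤ x → ρ x = x) → bCode σ = bCode ρ → σ = ρ := by
  induction m with
  | zero =>
    intro σ ρ h1 h2 _
    ext x
    rw [h1 x (Nat.zero_le _), h2 x (Nat.zero_le _)]
  | succ m ih =>
    intro σ ρ h1 h2 h
    by_cases hm : m < n
    swap
    · exact ih σ ρ (fun x hx => absurd x.isLt (by omega)) (fun x hx => absurd x.isLt (by omega)) h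
    obtain ⟨j, hj⟩ : ∃ j : Fin n, (j : ℕ) = m := ⟨⟨m, hm⟩, rfl⟩
    have hle : ∀ π : Perm (Fin n), (∀ x : Fin n, m + 1 ≤ x → π x = x) → π⁻¹ j ≤ j := by
      intro π hπ
      by_contra hcon
      rw [not_le] at hcon
      have h3 := hπ (π⁻¹ j) (by rw [Fin.lt_def] at hcon; omega)
      rw [perm_apply_inv] at h3
      exact hcon.ne h3
    have hfix : ∀ π : Perm (Fin n), (∀ x : Fin n, m + 1 ≤ x → π x = x) →
        ∀ x, j < x → π x = x := by
      intro π hπ x hx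
      exact hπ x (by rw [Fin.lt_def] at hx; omega)
    have hfix' : ∀ π : Perm (Fin n), (∀ x : Fin n, m + 1 ≤ x → π x = x) →
        ∀ x : Fin n, m ≤ x → (π * swap (π⁻¹ j) j) x = x := by
      intro π hπ x hx
      rw [Perm.mul_apply]
      rcases eq_or_ne x j with rfl | hne
      · rw [swap_apply_right, perm_apply_inv]
      · have hlt : j < x := lt_of_le_of_ne (by rw [Fin.le_def]; omega) hne.symm
        rw [swap_apply_of_ne_of_ne ((hle π hπ).trans_lt hlt).ne' hne, hfix π hπ x hlt]
    have hi : σ⁻¹ j = ρ⁻¹ j := by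
      have h3 := bCode_of_inv_le (hle σ h1)
      rw [h, bCode_of_inv_le (hle ρ h2)] at h3
      exact Fin.ext (by omega)
    have heq := ih _ _ (hfix' σ h1) (hfix' ρ h2) (SE_ext fun c => by
      rcases eq_or_ne c j with rfl | hc
      · rw [bCode_of_fixed (hfix' σ h1 c hj.ge), bCode_of_fixed (hfix' ρ h2 c hj.ge)]
      · rw [bCode_mul_swap_of_ne (by simp) (hle σ h1) (hfix σ h1) hc,
          bCode_mul_swap_of_ne (by simp) (hle ρ h2) (hfix ρ h2) hc, h])
    rw [hi] at heq
    exact mul_right_cancel heq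

theorem bCode_bijective : Function.Bijective (bCode : Perm (Fin n) → SE n) :=
  bijective_of_injective_SE fun σ ρ h =>
    eq_of_bCode_eq n σ ρ (fun x hx => absurd x.isLt (by omega))
      (fun x hx => absurd x.isLt (by omega)) h

/-- Removing the last transposition `(i j)` makes `j` a fixed point: its deficit drops from `j - i`
to zero, and no other entry changes. -/
theorem IsSortingDecomposition.sum_eq (L : List (Fin n × Fin n)) :
    ∀ σ : Perm (Fin n), IsSortingDecomposition σ L →
    (L.map fun p => (p.2 : ℕ) - (p.1 : ℕ)).sum = ∑ c : Fin n, ((c : ℕ) + 1 - (bCode σ).1 c) := by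
  induction L using List.reverseRecOn with
  | nil =>
    intro σ h
    obtain rfl : 1 = σ := by simpa using h.prod_eq
    refine (Finset.sum_eq_zero fun c _ => ?_).symm
    rw [bCode_of_fixed rfl, Nat.sub_self]
  | append_singleton L q ih =>
    intro σ h
    obtain ⟨i, j⟩ := q
    have hinc := List.pairwise_append.1 h.increasing
    have hlt : ∀ p ∈ L, p.1 < p.2 := fun p hp => h.lt p (by simp [hp])
    have hij : i < j := h.lt (i, j) (by simp)
    have hprod : (L.map fun p => swap p.1 p.2).prod * swap i j = σ := by
      simpa using h.prod_eq
    have hprod' : (L.map fun p => swap p.1 p.2).prod = σ * swap i j := by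
      rw [← hprod, mul_assoc, swap_mul_self, mul_one]
    have hfix : ∀ x, j ≤ x → (L.map fun p => swap p.1 p.2).prod x = x := fun x hx =>
      prod_swap_fix x L hlt fun p hp => (hinc.2.2 p hp (i, j) (by simp)).trans_le hx
    have hσi : σ i = j := by
      rw [← hprod, Perm.mul_apply, swap_apply_left, hfix j le_rfl]
    have hσ : ∀ x, j < x → σ x = x := fun x hx => by
      rw [← hprod, Perm.mul_apply, swap_apply_of_ne_of_ne (hij.trans hx).ne' hx.ne', hfix x hx.le]
    have hσj : σ⁻¹ j = i := by rw [← hσi, perm_inv_apply]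
    rw [List.map_append, List.sum_append, ih _ ⟨hinc.1, hlt, hprod'⟩,
      ← Finset.add_sum_erase _ _ (Finset.mem_univ j),
      ← Finset.add_sum_erase _ (fun c : Fin n => (c : ℕ) + 1 - (bCode σ).1 c) (Finset.mem_univ j),
      bCode_of_fixed (by rw [← hprod', hfix j le_rfl]),
      bCode_of_inv_le (σ := σ) (hσj.le.trans hij.le), hσj,
      Finset.sum_congr rfl fun c hc => by
        rw [bCode_mul_swap_of_ne hσi hij.le hσ (Finset.ne_of_mem_erase hc)]]
    simp only [List.map_cons, List.map_nil, List.sum_cons, List.sum_nil]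
    omega

theorem sor_eq_sum (σ : Perm (Fin n)) : sor σ = ∑ c : Fin n, ((c : ℕ) + 1 - (bCode σ).1 c) :=
  IsSortingDecomposition.sum_eq _ σ (existsUnique_sortingDecomposition σ).choose_spec.1

/-! ### The map `γ` -/

theorem bCode_gamma (σ : Perm (Fin n)) : bCode (gamma σ) = aCode σ :=
  Function.rightInverse_invFun bCode_bijective.2 (aCode σ)

theorem gamma_bijective : Function.Bijective (gamma : Perm (Fin n) → Perm (Fin n)) := by
  have h : Function.Bijective (bCode ∘ (gamma : Perm (Fin n) → Perm (Fin n))) := by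
    rw [show bCode ∘ gamma = (aCode : Perm (Fin n) → SE n) from funext bCode_gamma]
    exact aCode_bijective
  exact (bCode_bijective.of_comp_iff' gamma).1 h

theorem gamma_mem_S_iff {k : ℕ} {σ : Perm (Fin n)} : gamma σ ∈ S n k ↔ σ ∈ S n k := by
  rw [mem_S_iff_bCode, mem_S_iff_aCode, bCode_gamma]

theorem gamma_bijOn (k : ℕ) : Set.BijOn gamma (S n k) (S n k) := by
  refine ⟨fun σ hσ => gamma_mem_S_iff.2 hσ, gamma_bijective.1.injOn, fun ρ hρ => ?_⟩
  obtain ⟨σ, rfl⟩ := gamma_bijective.2 ρ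
  exact ⟨σ, gamma_mem_S_iff.1 hρ, rfl⟩

theorem inv_eq_sor_gamma (σ : Perm (Fin n)) : inv σ = sor (gamma σ) := by
  rw [inv_eq_sum, sor_eq_sum, bCode_gamma]

theorem Rmil_eq_Cyc_gamma (σ : Perm (Fin n)) : Rmil σ = Cyc (gamma σ) := by
  rw [Rmil_eq, Cyc_eq, bCode_gamma]

theorem ncard_sep_eq_of_bijOn {α : Type*} {s : Set α} {g : α → α} (hg : Set.BijOn g s s)
    {p q : α → Prop} (h : ∀ x ∈ s, p x ↔ q (g x)) :
    {x ∈ s | p x}.ncard = {x ∈ s | q x}.ncard := by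
  have himg : {x ∈ s | q x} = g '' {x ∈ s | p x} := by
    ext y
    constructor
    · rintro ⟨hy, hq⟩
      obtain ⟨x, hx, rfl⟩ := hg.surjOn hy
      exact ⟨x, ⟨hx, (h x hx).2 hq⟩, rfl⟩
    · rintro ⟨x, ⟨hx, hp⟩, rfl⟩
      exact ⟨hg.mapsTo hx, (h x hx).1 hp⟩
  rw [himg, Set.InjOn.ncard_image (hg.injOn.mono fun x hx => hx.1)]

end FoataHan

theorem mainTheorem5 (n k : ℕ) :
    -- both codes are bijections onto `SE_n`, so that `γ` is a well-defined bijection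
    Function.Bijective (FoataHan.aCode : Equiv.Perm (Fin n) → FoataHan.SE n) ∧
    Function.Bijective (FoataHan.bCode : Equiv.Perm (Fin n) → FoataHan.SE n) ∧
    -- `γ` restricts to a bijection of `S(n,k)`
    Set.BijOn FoataHan.gamma (FoataHan.S n k) (FoataHan.S n k) ∧
    -- and carries `(inv, Rmil)` to `(sor, Cyc)`
    (∀ σ ∈ FoataHan.S n k,
      FoataHan.inv σ = FoataHan.sor (FoataHan.gamma σ) ∧
      FoataHan.Rmil σ = FoataHan.Cyc (FoataHan.gamma σ)) ∧
    -- equidistribution over `S(n,k)`, for the set-valued and the numerical statistics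
    (∀ (a : ℕ) (C : Set (Fin n)),
      {σ ∈ FoataHan.S n k | FoataHan.inv σ = a ∧ FoataHan.Rmil σ = C}.ncard =
      {σ ∈ FoataHan.S n k | FoataHan.sor σ = a ∧ FoataHan.Cyc σ = C}.ncard) ∧
    (∀ a b : ℕ,
      {σ ∈ FoataHan.S n k | FoataHan.inv σ = a ∧ FoataHan.rmin σ = b}.ncard =
      {σ ∈ FoataHan.S n k | FoataHan.sor σ = a ∧ FoataHan.cyc σ = b}.ncard) := by
  refine ⟨FoataHan.aCode_bijective, FoataHan.bCode_bijective, FoataHan.gamma_bijOn k,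
    fun σ _ => ⟨FoataHan.inv_eq_sor_gamma σ, FoataHan.Rmil_eq_Cyc_gamma σ⟩,
    fun a C => FoataHan.ncard_sep_eq_of_bijOn (FoataHan.gamma_bijOn k) fun σ _ => ?_,
    fun a b => FoataHan.ncard_sep_eq_of_bijOn (FoataHan.gamma_bijOn k) fun σ _ => ?_⟩
  · rw [FoataHan.inv_eq_sor_gamma, FoataHan.Rmil_eq_Cyc_gamma]
  · rw [FoataHan.inv_eq_sor_gamma, FoataHan.rmin, FoataHan.cyc, FoataHan.Rmil_eq_Cyc_gamma]
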